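/- \textbf{Sparse datasets admit low-dimensional quantum models.} For integers $U\ge 1$ and $I,Z\ge 0$ let $[U]$ be the set of users, $[I]$ the set of items and $[Z]$ the set of possible ratings. Let $R\in[Z]^{U\times I}$ be the rating matrix ($R_{ui}$ is the rating of item $i$ by user $u$) and let $\Gamma\subseteq[U]\times[I]$ be the set of positions of its known entries. A $d$-dimensional quantum model consists of positive semidefinite complex $d\times d$ matrices $\rho_u$ ($u\in[U]$) with $\mathrm{tr}(\rho_u)=1$, and positive semidefinite complex $d\times d$ matrices $E_{iz}$ ($i\in[I]$, $z\in[Z]$) with $\sum_{z\in[Z]}E_{iz}=\mathbb{I}$ for every $i$. There is an absolute constant $C>0$ and, for every $N\in\mathbb{N}$, a constant $K=K(N)>0$ depending only on $N$ such that the following holds for all $U,I,Z,R,\Gamma$ as above. Let $J=U+IZ$, let $\varepsilon$ satisfy $\frac{4}{\sqrt{JU}}\le\varepsilon\le\frac12$, and suppose that each item has been rated at most $N$ times, i.e. $|\{u\in[U]:(u,i)\in\Gamma\}|\le N$ for all $i\in[I]$. Then for some $d\le C\,\varepsilon^{-2}\ln(4JU)$ there exists a $d$-dimensional quantum model $\bigl((\rho_u)_u,(E_{iz})_{iz}\bigr)$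 satisfying \[ |\delta_{z,R_{ui}}-\mathrm{tr}(\rho_uE_{iz})|\le K\,\varepsilon\qquad\text{for all }(u,i)\in\Gamma\text{ and all }z\in[Z]. \] -/

import Mathlib

open scoped ComplexOrder

/-- A `d`-dimensional quantum state (density matrix): a positive semidefinite complex
`d × d` matrix of trace one. -/
def IsQuantumState {d : ℕ} (ρ : Matrix (Fin d) (Fin d) ℂ) : Prop :=
  ρ.PosSemidef ∧ ρ.trace = 1

/-- A `d`-dimensional quantum measurement (POVM) with `Z` outcomes: positive semidefinite
complex `d × d` matrices that sum to the identity. -/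
def IsQuantumMeasurement {d Z : ℕ} (E : Fin Z → Matrix (Fin d) (Fin d) ℂ) : Prop :=
  (∀ z, (E z).PosSemidef) ∧ ∑ z, E z = 1

/-- A `d`-dimensional quantum model for `U` users, `I` items and `Z` possible ratings:
each user is represented by a quantum state and each item by a quantum measurement whose
outcomes are the ratings. -/
def IsQuantumModel {d U I Z : ℕ} (ρ : Fin U → Matrix (Fin d) (Fin d) ℂ)
    (E : Fin I → Fin Z → Matrix (Fin d) (Fin d) ℂ) : Prop :=
  (∀ u, IsQuantumState (ρ u)) ∧ ∀ i, IsQuantumMeasurement (E i)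

/-- The number of times item `i` has been rated, where `Γ` is the set of user-item pairs
with a known rating. -/
def ratingCount {U I : ℕ} (Γ : Finset (Fin U × Fin I)) (i : Fin I) : ℕ :=
  (Finset.univ.filter fun u : Fin U => (u, i) ∈ Γ).card

/-!
The users are represented by pure states `ψ u ψ u*` whose vectors are pairwise almost orthogonal,
`|⟪ψ u, ψ v⟫| ≤ ε`. Such a family of `U` unit vectors exists in dimension `O(ε⁻² log (2U))`: it
consists of normalized sign vectors picked one after the other, where by the moment generating
function bound for a uniformly random sign vector the next one can be chosen almost orthogonal to
all its predecessors (`exists_signVector_abs_sum_le`, `exists_almostOrthonormal`).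

For an item, let `S` be the set of its at most `N` raters. Almost orthogonal vectors satisfy an
approximate Bessel inequality `∑ u ∈ S, |⟪ψ u, x⟫|² ≤ (1 + N ε) ‖x‖²`
(`sum_norm_inner_sq_le_of_almostOrthonormal`), so the projections `ψ u ψ u*`, scaled down by
`c = 1 / (1 + N ε)`, sum to at most the identity. Grouping them by the rating given and
assigning the missing part of the identity to an arbitrary outcome yields a measurement
(`ratingMeasurement`). On the state of a rater it returns the correct rating with probability at
least `c ≥ 1 - N ε`. As probabilities are nonnegative and sum to one, every outcome probability
is then correct up to `N ε`.
-/

open Finset Matrix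
open scoped InnerProductSpace

/-! ### Almost orthogonal sign vectors -/

/-- The moment generating function of a signed sum `∑ j, s j * v j` at `t`, summed over all sign
vectors `s`; it factorizes into `(2 * cosh t) ^ d`. -/
lemma sum_exp_signVector_le {d : ℕ} (v : Fin d → ℝ) (hv : ∀ j, v j = 1 ∨ v j = -1) (t : ℝ) :
    ∑ s ∈ Fintype.piFinset (fun _ : Fin d => ({1, -1} : Finset ℝ)),
        Real.exp (t * ∑ j, s j * v j) ≤ 2 ^ d * Real.exp (d * t ^ 2 / 2) := by
  have h1 : ∀ s : Fin d → ℝ, Real.exp (t * ∑ j, s j * v j) = ∏ j, Real.exp (t * (s j * v j)) :=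
    fun s => by rw [mul_sum, Real.exp_sum]
  simp_rw [h1]
  rw [← prod_univ_sum (fun _ : Fin d => ({1, -1} : Finset ℝ)) (fun j x => Real.exp (t * (x * v j)))]
  have h2 : ∀ j, ∑ x ∈ ({1, -1} : Finset ℝ), Real.exp (t * (x * v j)) = 2 * Real.cosh t := by
    intro j
    rw [sum_pair (by norm_num), Real.cosh_eq]
    rcases hv j with h | h <;> simp only [h] <;> ring_nf
  simp_rw [h2]
  rw [prod_const, card_univ, Fintype.card_fin, mul_pow]
  gcongr
  calc Real.cosh t ^ d ≤ Real.exp (t ^ 2 / 2) ^ d := by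
        gcongr
        exact Real.cosh_le_exp_half_sq t
    _ = Real.exp (d * t ^ 2 / 2) := by rw [← Real.exp_nat_mul]; ring_nf

/-- Given `k` sign vectors of length `d ≥ 2 ε⁻² log (2k)`, some sign vector has correlation at most
`ε * d` with each of them. -/
lemma exists_signVector_abs_sum_le {d k : ℕ} {ε : ℝ} (hε : 0 < ε)
    (hd : 2 / ε ^ 2 * Real.log (2 * k) ≤ d) (f : Fin k → Fin d → ℝ)
    (hf : ∀ a j, f a j = 1 ∨ f a j = -1) :
    ∃ s : Fin d → ℝ, (∀ j, s j = 1 ∨ s j = -1) ∧ ∀ a, |∑ j, s j * f a j| ≤ ε * d := by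
  set T := Fintype.piFinset (fun _ : Fin d => ({1, -1} : Finset ℝ)) with hT
  have hcard : (T.card : ℝ) = 2 ^ d := by
    rw [hT, Fintype.card_piFinset_const, card_pair (by norm_num)]; simp
  have hne : T.Nonempty := by
    rw [hT, Fintype.piFinset_nonempty]; simp
  -- A sign vector on which the sum of the two-sided exponential moments is at most average.
  obtain ⟨s, hsT, hs⟩ : ∃ s ∈ T, ∑ a, (Real.exp (ε * ∑ j, s j * f a j) +
      Real.exp (-ε * ∑ j, s j * f a j)) ≤ 2 * k * Real.exp (d * ε ^ 2 / 2) := by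
    apply exists_le_of_sum_le hne
    rw [sum_comm, sum_const, nsmul_eq_mul, hcard]
    calc ∑ a, ∑ s ∈ T, (Real.exp (ε * ∑ j, s j * f a j) + Real.exp (-ε * ∑ j, s j * f a j))
        ≤ ∑ _a : Fin k, (2 ^ d * Real.exp (d * ε ^ 2 / 2) + 2 ^ d * Real.exp (d * ε ^ 2 / 2)) := by
          refine sum_le_sum fun a _ => ?_
          rw [sum_add_distrib]
          refine add_le_add (sum_exp_signVector_le (f a) (hf a) ε) ?_
          simpa using sum_exp_signVector_le (f a) (hf a) (-ε)
      _ = 2 ^ d * (2 * k * Real.exp (d * ε ^ 2 / 2)) := by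
          rw [sum_const, card_univ, Fintype.card_fin, nsmul_eq_mul]; ring
  refine ⟨s, fun j => by simpa using Fintype.mem_piFinset.1 hsT j, fun a => ?_⟩
  have hk : (0 : ℝ) < 2 * k := by
    have : 0 < k := a.pos
    positivity
  have hle := (single_le_sum (f := fun a => Real.exp (ε * ∑ j, s j * f a j) +
    Real.exp (-ε * ∑ j, s j * f a j)) (fun a _ => by positivity) (mem_univ a)).trans hs
  have hd' : Real.log (2 * k) ≤ d * ε ^ 2 / 2 := by
    rw [div_mul_eq_mul_div, div_le_iff₀ (by positivity)] at hd
    linarith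
  have key : ∀ x : ℝ, Real.exp x ≤ 2 * k * Real.exp (d * ε ^ 2 / 2) → x ≤ d * ε ^ 2 := by
    intro x hx
    rw [← Real.exp_log hk, ← Real.exp_add, Real.exp_le_exp] at hx
    linarith
  have e1 := key (ε * ∑ j, s j * f a j) (by
    have := Real.exp_pos (-ε * ∑ j, s j * f a j)
    linarith)
  have e2 := key (-ε * ∑ j, s j * f a j) (by
    have := Real.exp_pos (ε * ∑ j, s j * f a j)
    linarith)
  rw [abs_le]
  constructor <;> nlinarith

lemma exists_almostOrthogonal_signVectors {d : ℕ} {ε : ℝ} (hε : 0 < ε) (k : ℕ)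
    (hd : 2 / ε ^ 2 * Real.log (2 * k) ≤ d) :
    ∃ f : Fin k → Fin d → ℝ, (∀ a j, f a j = 1 ∨ f a j = -1) ∧
      ∀ a b, a ≠ b → |∑ j, f a j * f b j| ≤ ε * d := by
  induction k with
  | zero => exact ⟨fun a => a.elim0, fun a => a.elim0, fun a => a.elim0⟩
  | succ k ih =>
    have hd' : 2 / ε ^ 2 * Real.log (2 * k) ≤ d := by
      rcases Nat.eq_zero_or_pos k with rfl | hk
      · simp
      · refine le_trans ?_ hd
        gcongr
        exact Nat.le_succ k
    obtain ⟨f, hf, hff⟩ := ih hd'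
    obtain ⟨s, hs, hsf⟩ := exists_signVector_abs_sum_le hε hd' f hf
    refine ⟨Fin.cons s f, fun a => ?_, fun a b => ?_⟩
    · cases a using Fin.cases
      · simpa using hs
      · simpa using hf _
    · cases a using Fin.cases <;> cases b using Fin.cases
      · simp
      · simpa using fun _ => hsf _
      · simpa [mul_comm] using hsf _
      · simpa using hff _ _

/-- Almost orthonormal families of `k` vectors exist in any dimension that is at least of order
`ε⁻² log (2k)`. -/
lemma exists_almostOrthonormal {d : ℕ} {ε : ℝ} (hε : 0 < ε) (k : ℕ) (hd0 : 0 < d)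
    (hd : 2 / ε ^ 2 * Real.log (2 * k) ≤ d) :
    ∃ ψ : Fin k → EuclideanSpace ℂ (Fin d), (∀ a, ‖ψ a‖ = 1) ∧
      ∀ a b, a ≠ b → ‖⟪ψ a, ψ b⟫_ℂ‖ ≤ ε := by
  obtain ⟨f, hf, hff⟩ := exists_almostOrthogonal_signVectors hε k hd
  have hdR : (0 : ℝ) < d := by exact_mod_cast hd0
  have hsq : Real.sqrt d * Real.sqrt d = d := Real.mul_self_sqrt hdR.le
  let ψ : Fin k → EuclideanSpace ℂ (Fin d) :=
    fun a => WithLp.toLp 2 fun j => ((f a j / Real.sqrt d : ℝ) : ℂ)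
  have hinner : ∀ a b, ⟪ψ a, ψ b⟫_ℂ = (((∑ j, f a j * f b j) / d : ℝ) : ℂ) := by
    intro a b
    rw [PiLp.inner_apply, sum_div, Complex.ofReal_sum]
    refine sum_congr rfl fun j _ => ?_
    simp only [ψ, RCLike.inner_apply, Complex.conj_ofReal, ← Complex.ofReal_mul]
    rw [div_mul_div_comm, hsq, mul_comm (f b j)]
  refine ⟨ψ, fun a => ?_, fun a b hab => ?_⟩
  · have h1 : ∑ j, f a j * f a j = d := by
      rw [sum_congr rfl (g := fun _ => (1 : ℝ))
        (fun j _ => by rcases hf a j with h | h <;> rw [h] <;> norm_num)]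
      simp
    have h2 := hinner a a
    rw [h1, div_self hdR.ne', inner_self_eq_norm_sq_to_K] at h2
    have h3 : ‖ψ a‖ ^ 2 = 1 := Complex.ofReal_injective (by simpa using h2)
    exact (pow_eq_one_iff_of_nonneg (norm_nonneg _) two_ne_zero).1 h3
  · rw [hinner, Complex.norm_real, Real.norm_eq_abs, abs_div, abs_of_pos hdR, div_le_iff₀ hdR]
    exact hff a b hab

/-! ### An approximate Bessel inequality -/

lemma sum_norm_inner_sq_le_of_almostOrthonormal {𝕜 E ι : Type*} [RCLike 𝕜]
    [NormedAddCommGroup E] [InnerProductSpace 𝕜 E] (S : Finset ι) (ψ : ι → E) {ε : ℝ}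
    (hε : 0 ≤ ε) (h1 : ∀ a ∈ S, ‖ψ a‖ = 1)
    (h2 : ∀ a ∈ S, ∀ b ∈ S, a ≠ b → ‖⟪ψ a, ψ b⟫_𝕜‖ ≤ ε) (x : E) :
    ∑ a ∈ S, ‖⟪ψ a, x⟫_𝕜‖ ^ 2 ≤ (1 + S.card * ε) * ‖x‖ ^ 2 := by
  classical
  set c : ι → 𝕜 := fun a => ⟪ψ a, x⟫_𝕜 with hc
  set T : ℝ := ∑ a ∈ S, ‖c a‖ ^ 2 with hT
  set y : E := ∑ a ∈ S, c a • ψ a with hy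
  have hT0 : 0 ≤ T := sum_nonneg fun a _ => by positivity
  have hyx : ⟪y, x⟫_𝕜 = ((T : ℝ) : 𝕜) := by
    rw [hy, sum_inner, hT, RCLike.ofReal_sum]
    refine sum_congr rfl fun a _ => ?_
    rw [inner_smul_left, RCLike.conj_mul, RCLike.ofReal_pow]
  have hTle : T ≤ ‖y‖ * ‖x‖ := by
    have := norm_inner_le_norm (𝕜 := 𝕜) y x
    rwa [hyx, RCLike.norm_ofReal, abs_of_nonneg hT0] at this
  have hyy : ‖y‖ ^ 2 ≤ (1 + S.card * ε) * T := by
    have e1 : ‖y‖ ^ 2 = ‖⟪y, y⟫_𝕜‖ := by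
      rw [inner_self_eq_norm_sq_to_K, norm_pow, RCLike.norm_ofReal, abs_of_nonneg (norm_nonneg y)]
    have e2 : ⟪y, y⟫_𝕜 = ∑ a ∈ S, ∑ b ∈ S, (starRingEnd 𝕜) (c a) * (c b * ⟪ψ a, ψ b⟫_𝕜) := by
      rw [hy, sum_inner]
      refine sum_congr rfl fun a _ => ?_
      rw [inner_smul_left, inner_sum, mul_sum]
      exact sum_congr rfl fun b _ => by rw [inner_smul_right]
    rw [e1, e2]
    calc ‖∑ a ∈ S, ∑ b ∈ S, (starRingEnd 𝕜) (c a) * (c b * ⟪ψ a, ψ b⟫_𝕜)‖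
        ≤ ∑ a ∈ S, ∑ b ∈ S, ‖(starRingEnd 𝕜) (c a) * (c b * ⟪ψ a, ψ b⟫_𝕜)‖ :=
          (norm_sum_le _ _).trans (sum_le_sum fun a _ => norm_sum_le _ _)
      _ ≤ ∑ a ∈ S, ∑ b ∈ S, ((if a = b then ‖c a‖ ^ 2 else 0) + ε * (‖c a‖ * ‖c b‖)) := by
          refine sum_le_sum fun a ha => sum_le_sum fun b hb => ?_
          rw [norm_mul, norm_mul, RCLike.norm_conj]
          split_ifs with hab
          · subst hab
            rw [inner_self_eq_norm_sq_to_K, h1 a ha]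
            have : 0 ≤ ε * (‖c a‖ * ‖c a‖) := by positivity
            simp only [RCLike.ofReal_one, one_pow, norm_one]
            nlinarith
          · have := mul_le_mul_of_nonneg_left (h2 a ha b hb hab)
              (mul_nonneg (norm_nonneg (c a)) (norm_nonneg (c b)))
            linarith
      _ = T + ε * (∑ a ∈ S, ‖c a‖) ^ 2 := by
          simp_rw [sum_add_distrib]
          congr 1
          · rw [hT]
            exact sum_congr rfl fun a ha => by simp [ha]
          · rw [sq, sum_mul_sum, mul_sum]
            simp_rw [mul_sum]
      _ ≤ T + ε * (S.card * T) := by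
          gcongr
          exact sq_sum_le_card_mul_sum_sq
      _ = (1 + S.card * ε) * T := by ring
  rcases hT0.eq_or_lt with h | h
  · rw [← h]; positivity
  · have : T * T ≤ ((1 + S.card * ε) * ‖x‖ ^ 2) * T := by
      calc T * T ≤ (‖y‖ * ‖x‖) * (‖y‖ * ‖x‖) := by gcongr
        _ = ‖y‖ ^ 2 * ‖x‖ ^ 2 := by ring
        _ ≤ ((1 + S.card * ε) * T) * ‖x‖ ^ 2 := by gcongr
        _ = _ := by ring
    exact le_of_mul_le_mul_right this h

/-! ### Pure states -/

/-- The rank-one matrix `ψ ψ*`, which is a quantum state when `ψ` is a unit vector. -/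
noncomputable def pureState {d : ℕ} (ψ : EuclideanSpace ℂ (Fin d)) : Matrix (Fin d) (Fin d) ℂ :=
  vecMulVec ψ.ofLp (star ψ.ofLp)

lemma posSemidef_pureState {d : ℕ} (ψ : EuclideanSpace ℂ (Fin d)) : (pureState ψ).PosSemidef :=
  posSemidef_vecMulVec_self_star _

lemma trace_pureState_mul {d : ℕ} (ψ : EuclideanSpace ℂ (Fin d)) (M : Matrix (Fin d) (Fin d) ℂ) :
    (pureState ψ * M).trace = star ψ.ofLp ⬝ᵥ (M *ᵥ ψ.ofLp) := by
  rw [pureState, vecMulVec_mul, trace_vecMulVec, dotProduct_comm, dotProduct_mulVec]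

lemma dotProduct_pureState_mulVec {d : ℕ} (φ ψ : EuclideanSpace ℂ (Fin d)) :
    star φ.ofLp ⬝ᵥ (pureState ψ *ᵥ φ.ofLp) = ((‖⟪ψ, φ⟫_ℂ‖ ^ 2 : ℝ) : ℂ) := by
  rw [pureState, vecMulVec_mulVec, op_smul_eq_smul, dotProduct_smul, smul_eq_mul,
    dotProduct_comm (star ψ.ofLp), dotProduct_comm (star φ.ofLp),
    ← EuclideanSpace.inner_eq_star_dotProduct, ← EuclideanSpace.inner_eq_star_dotProduct,
    ← inner_conj_symm φ ψ, RCLike.mul_conj]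
  simp

lemma dotProduct_star_self {d : ℕ} (φ : EuclideanSpace ℂ (Fin d)) :
    star φ.ofLp ⬝ᵥ φ.ofLp = ((‖φ‖ ^ 2 : ℝ) : ℂ) := by
  rw [dotProduct_comm, ← EuclideanSpace.inner_eq_star_dotProduct, inner_self_eq_norm_sq_to_K]
  simp

lemma isQuantumState_pureState {d : ℕ} {ψ : EuclideanSpace ℂ (Fin d)} (h : ‖ψ‖ = 1) :
    IsQuantumState (pureState ψ) := by
  refine ⟨posSemidef_pureState ψ, ?_⟩
  rw [← mul_one (pureState ψ), trace_pureState_mul, one_mulVec, dotProduct_star_self, h]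
  simp

/-! ### The measurement of an item -/

/-- The measurement built from the raters `S` of an item and their ratings `r`: outcome `z`
collects the matrices `c • ψ u ψ u*` of the users `u` who gave the rating `z`, and the outcome
`z₀` moreover receives the part of the identity not covered by these. -/
noncomputable def ratingMeasurement {ι : Type*} {d Z : ℕ} (ψ : ι → EuclideanSpace ℂ (Fin d))
    (S : Finset ι) (r : ι → Fin Z) (c : ℝ) (z₀ z : Fin Z) : Matrix (Fin d) (Fin d) ℂ :=
  ∑ u ∈ S with r u = z, c • pureState (ψ u) +
    if z = z₀ then 1 - ∑ u ∈ S, c • pureState (ψ u) else 0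

/-- The approximate Bessel inequality as a bound between Hermitian matrices. -/
lemma posSemidef_one_sub_sum_pureState {ι : Type*} {d : ℕ} {ψ : ι → EuclideanSpace ℂ (Fin d)}
    {S : Finset ι} {c : ℝ} (hc : 0 ≤ c)
    (hB : ∀ x, c * ∑ u ∈ S, ‖⟪ψ u, x⟫_ℂ‖ ^ 2 ≤ ‖x‖ ^ 2) :
    (1 - ∑ u ∈ S, c • pureState (ψ u)).PosSemidef := by
  refine .of_dotProduct_mulVec_nonneg ?_ fun x => ?_
  · exact isHermitian_one.sub
      (posSemidef_sum S fun u _ => (posSemidef_pureState (ψ u)).smul hc).isHermitian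
  · obtain ⟨x, rfl⟩ : ∃ y : EuclideanSpace ℂ (Fin d), y.ofLp = x := ⟨WithLp.toLp 2 x, rfl⟩
    rw [sub_mulVec, one_mulVec, dotProduct_sub, sum_mulVec, dotProduct_sum, dotProduct_star_self]
    simp_rw [smul_mulVec, dotProduct_smul, dotProduct_pureState_mulVec, Complex.real_smul,
      ← Complex.ofReal_mul]
    rw [← Complex.ofReal_sum, ← Complex.ofReal_sub, Complex.zero_le_real, sub_nonneg, ← mul_sum]
    exact hB x

lemma isQuantumMeasurement_ratingMeasurement {ι : Type*} {d Z : ℕ}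
    {ψ : ι → EuclideanSpace ℂ (Fin d)} {S : Finset ι} (r : ι → Fin Z) {c : ℝ} (z₀ : Fin Z)
    (hc : 0 ≤ c) (hB : ∀ x, c * ∑ u ∈ S, ‖⟪ψ u, x⟫_ℂ‖ ^ 2 ≤ ‖x‖ ^ 2) :
    IsQuantumMeasurement (ratingMeasurement ψ S r c z₀) := by
  refine ⟨fun z => ?_, ?_⟩
  · refine (posSemidef_sum _ fun u _ => (posSemidef_pureState (ψ u)).smul hc).add ?_
    split_ifs
    · exact posSemidef_one_sub_sum_pureState hc hB
    · exact PosSemidef.zero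
  · simp only [ratingMeasurement, sum_add_distrib, sum_fiberwise, sum_ite_eq', mem_univ, if_true]
    abel

/-- On the state of a rater `v`, the measurement returns the rating given by `v` with probability
at least `c`. -/
lemma le_trace_pureState_mul_ratingMeasurement {ι : Type*} {d Z : ℕ}
    {ψ : ι → EuclideanSpace ℂ (Fin d)} {S : Finset ι} (r : ι → Fin Z) {c : ℝ} (z₀ : Fin Z)
    (hc : 0 ≤ c) (hB : ∀ x, c * ∑ u ∈ S, ‖⟪ψ u, x⟫_ℂ‖ ^ 2 ≤ ‖x‖ ^ 2) {v : ι} (hv : v ∈ S)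
    (hψ : ‖ψ v‖ = 1) :
    (c : ℂ) ≤ (pureState (ψ v) * ratingMeasurement ψ S r c z₀ (r v)).trace := by
  have hrest : 0 ≤ star (ψ v).ofLp ⬝ᵥ
      ((if r v = z₀ then 1 - ∑ u ∈ S, c • pureState (ψ u) else 0) *ᵥ (ψ v).ofLp) := by
    split_ifs
    · exact (posSemidef_one_sub_sum_pureState hc hB).dotProduct_mulVec_nonneg _
    · simp
  rw [trace_pureState_mul, ratingMeasurement, add_mulVec, dotProduct_add]
  refine le_add_of_le_of_nonneg ?_ hrest
  rw [sum_mulVec, dotProduct_sum]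
  simp_rw [smul_mulVec, dotProduct_smul, dotProduct_pureState_mulVec, Complex.real_smul,
    ← Complex.ofReal_mul]
  rw [← Complex.ofReal_sum, Complex.real_le_real]
  have := single_le_sum (f := fun u => c * ‖⟪ψ u, ψ v⟫_ℂ‖ ^ 2)
    (fun u _ => by positivity) (mem_filter.2 ⟨hv, rfl⟩ : v ∈ S.filter fun u => r u = r v)
  refine le_trans ?_ this
  simp [hψ]

/-- If a probability distribution gives mass at least `c` to one outcome, then it is within `1 - c`
of the point mass there, outcome by outcome. -/
lemma norm_pointMass_sub_le {ι : Type*} [Fintype ι] [DecidableEq ι] {p : ι → ℂ} {c : ℝ} {r : ι}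
    (h0 : ∀ z, 0 ≤ p z) (h1 : ∑ z, p z = 1) (hr : (c : ℂ) ≤ p r) (z : ι) :
    ‖(if z = r then (1 : ℂ) else 0) - p z‖ ≤ 1 - c := by
  obtain ⟨q, rfl⟩ : ∃ q : ι → ℝ, p = fun z => (q z : ℂ) :=
    ⟨fun z => (p z).re, funext fun z => Complex.eq_re_of_ofReal_le (r := 0) (by simpa using h0 z)⟩
  simp only [Complex.zero_le_real] at h0
  rw [Complex.real_le_real] at hr
  have h1' : ∑ z, q z = 1 := Complex.ofReal_injective (by simpa using h1)
  split_ifs with h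
  · subst h
    have : q z ≤ 1 := h1' ▸ single_le_sum (fun z _ => h0 z) (mem_univ z)
    rw [← Complex.ofReal_one, ← Complex.ofReal_sub, Complex.norm_real, Real.norm_eq_abs,
      abs_of_nonneg (by linarith)]
    linarith
  · have : q z + q r ≤ 1 := by
      rw [← h1', ← sum_pair h]
      exact sum_le_sum_of_subset_of_nonneg (subset_univ _) fun z _ _ => h0 z
    rw [zero_sub, norm_neg, Complex.norm_real, Real.norm_eq_abs, abs_of_nonneg (h0 z)]
    linarith

theorem mainTheorem2 :
    ∃ C : ℝ, 0 < C ∧ ∀ N : ℕ, ∃ K : ℝ, 0 < K ∧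
      ∀ (U I Z J : ℕ) (R : Fin U → Fin I → Fin Z) (Γ : Finset (Fin U × Fin I)) (ε : ℝ),
        0 < U → J = U + I * Z →
        4 / Real.sqrt ((J : ℝ) * (U : ℝ)) ≤ ε → ε ≤ 1 / 2 →
        (∀ i : Fin I, ratingCount Γ i ≤ N) →
        ∃ d : ℕ, (d : ℝ) ≤ C * (1 / ε ^ 2 * Real.log (4 * (J : ℝ) * (U : ℝ))) ∧
          ∃ (ρ : Fin U → Matrix (Fin d) (Fin d) ℂ)
            (E : Fin I → Fin Z → Matrix (Fin d) (Fin d) ℂ),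
            IsQuantumModel ρ E ∧
              ∀ (u : Fin U) (i : Fin I), (u, i) ∈ Γ → ∀ z : Fin Z,
                ‖(if z = R u i then (1 : ℂ) else 0) - (ρ u * E i z).trace‖ ≤ K * ε := by
  refine ⟨4, by norm_num, fun N => ⟨N + 1, by positivity, ?_⟩⟩
  intro U I Z J R Γ ε hU hJ hε hε2 hN
  have hU1 : (1 : ℝ) ≤ U := by exact_mod_cast hU
  have hJU : (U : ℝ) ≤ J := by rw [hJ]; exact_mod_cast Nat.le_add_right _ _
  have hJ1 : (1 : ℝ) ≤ J := hU1.trans hJU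
  have hε0 : 0 < ε := lt_of_lt_of_le (by positivity) hε
  set X : ℝ := 1 / ε ^ 2 * Real.log (4 * J * U) with hX
  have hJU1 : 1 ≤ (J : ℝ) * U := one_le_mul_of_one_le_of_one_le hJ1 hU1
  have hlog : 1 ≤ Real.log (4 * J * U) := by
    rw [Real.le_log_iff_exp_le (by positivity)]
    linarith [Real.exp_one_lt_d9]
  have hX1 : 1 ≤ X := by
    have : 1 ≤ 1 / ε ^ 2 := by
      rw [le_div_iff₀ (by positivity)]
      nlinarith
    nlinarith
  have hlow : 2 / ε ^ 2 * Real.log (2 * U) ≤ 2 * X := by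
    rw [hX, ← mul_assoc, mul_one_div]
    gcongr
    nlinarith
  obtain ⟨ψ, hψ1, hψ2⟩ := exists_almostOrthonormal (d := ⌈2 * X⌉₊) hε0 U
    (Nat.ceil_pos.2 (by linarith)) (hlow.trans (Nat.le_ceil _))
  refine ⟨⌈2 * X⌉₊, by linarith [Nat.ceil_lt_add_one (a := 2 * X) (by linarith)], ?_⟩
  let S : Fin I → Finset (Fin U) := fun i => univ.filter fun u => (u, i) ∈ Γ
  let c : ℝ := 1 / (1 + N * ε)
  have hpos : 0 < 1 + N * ε := by positivity
  have hc : 0 ≤ c := by positivity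
  have hB : ∀ i x, c * ∑ u ∈ S i, ‖⟪ψ u, x⟫_ℂ‖ ^ 2 ≤ ‖x‖ ^ 2 := by
    intro i x
    have hcard : ((S i).card : ℝ) ≤ N := by exact_mod_cast hN i
    rw [one_div_mul_eq_div, div_le_iff₀' hpos]
    refine (sum_norm_inner_sq_le_of_almostOrthonormal (S i) ψ hε0.le (fun a _ => hψ1 a)
      (fun a _ b _ => hψ2 a b) x).trans ?_
    gcongr
  -- The rating by the first user only serves as an arbitrary element of `Fin Z`.
  let E : Fin I → Fin Z → Matrix (Fin ⌈2 * X⌉₊) (Fin ⌈2 * X⌉₊) ℂ :=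
    fun i => ratingMeasurement ψ (S i) (fun u => R u i) c (R ⟨0, hU⟩ i)
  have hE : ∀ i, IsQuantumMeasurement (E i) :=
    fun i => isQuantumMeasurement_ratingMeasurement _ _ hc (hB i)
  refine ⟨fun u => pureState (ψ u), E, ⟨fun u => isQuantumState_pureState (hψ1 u), hE⟩, ?_⟩
  intro u i hui z
  refine (norm_pointMass_sub_le (p := fun z => (pureState (ψ u) * E i z).trace) (c := c)
    (fun z => ?_) ?_ ?_ z).trans ?_
  · rw [trace_pureState_mul]
    exact ((hE i).1 z).dotProduct_mulVec_nonneg _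
  · rw [← trace_sum, ← mul_sum, (hE i).2, mul_one]
    exact (isQuantumState_pureState (hψ1 u)).2
  · exact le_trace_pureState_mul_ratingMeasurement (fun u => R u i) _ hc (hB i)
      (mem_filter.2 ⟨mem_univ u, hui⟩) (hψ1 u)
  · have : 1 - N * ε ≤ c := by
      rw [le_div_iff₀ hpos]
      nlinarith [sq_nonneg (N * ε)]
    linarith
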